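/- Let ${\bf t} = t(0)\,t(1)\,t(2)\cdots$ be the Thue–Morse sequence, i.e. $t(i)$ is the sum, modulo $2$, of the binary digits of $i$. A finite word $w$ is called bordered if it begins and ends with the same word $x$, where $0 < |x| \le |w|/2$; otherwise it is unbordered. Then for every integer $n \ge 0$, the sequence ${\bf t}$ has an unbordered factor of length $n$ (that is, there is $j \ge 0$ such that the word $t(j)\,t(j+1)\cdots t(j+n-1)$ is unbordered) if and only if the base-2 representation of $n$ (without leading zeros, starting with the most significant digit; the empty word for $n = 0$) does not belong to the regular language $1(01^*0)^*10^*1$. -/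

import Mathlib

/-- The Thue–Morse sequence: `thueMorse n` is the sum, modulo 2, of the base-2
digits of `n`. -/
def thueMorse (n : ℕ) : ℕ := (Nat.digits 2 n).sum % 2

/-- The factor `x[j..j+n-1]` of length `n` beginning at position `j` of the sequence `x`. -/
def seqFactor {α : Type*} (x : ℕ → α) (j n : ℕ) : List α :=
  (List.range n).map fun i => x (j + i)

/-- `w` is bordered if it begins and ends with the same word `u`, where `0 < |u| ≤ |w| / 2`. -/
def IsBordered {α : Type*} (w : List α) : Prop :=
  ∃ u : List α, 0 < u.length ∧ 2 * u.length ≤ w.length ∧ u <+: w ∧ u <:+ w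

/-- The sequence `x` has an unbordered factor of length `n`. -/
def HasUnborderedFactor {α : Type*} (x : ℕ → α) (n : ℕ) : Prop :=
  ∃ j : ℕ, ¬ IsBordered (seqFactor x j n)

/-- The base-2 representation of `n` without leading zeros, most significant digit first
(the empty word for `n = 0`). -/
def binaryRep (n : ℕ) : List ℕ := (Nat.digits 2 n).reverse

open RegularExpression in
/-- The regular expression `1(01*0)*10*1`. -/
def borderedLengthRegex : RegularExpression ℕ :=
  char 1 * (char 0 * (char 1).star * char 0).star * char 1 * (char 0).star * char 1

/-! A word is unbordered iff it has no proper period. Since `t(2n) = t(n)` and `t(2n+1) = 1 - t(n)`,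
a factor of `t` lies over a parent factor of about half its length, and its even periods are twice
those of the parent (`hasPeriodOn_double`). An odd period leaves a border of length at most 3,
because equal factors of length 4 occur at positions of equal parity (`thueMorseBool_four_parity`).
Such short borders can be read off the end letters of the parent (`noBorderAbove_double`).

So it suffices to record, for each length, which pairs of end letters occur, along with a flag that
tolerates borders of length 1. Only eight such sets of profiles arise. Those of `2n`, `2n+1`,
`2n+2`, `2n+3` depend only on those of `n`, `n+1`, `n+2`, so they are computed by a finite automaton
reading the binary digits of `n`. Its product with the automaton of the regular expression has 14
states from length 2 on. In each of them, no unbordered profile exists exactly when the regex state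
accepts (`exists_inClass_iff`). -/

/-! ### The regular expression as an automaton on binary digits -/

open RegularExpression in
/-- The language `1(01*0)*`. -/
def leadLang : Language ℕ := ((char 1 * (char 0 * (char 1).star * char 0).star).matches')

open RegularExpression in
/-- The language `1(01*0)*01*`. -/
def loopLang : Language ℕ := leadLang * (char 0 * (char 1).star).matches'

open RegularExpression in
/-- The language `1(01*0)*10*`. -/
def tailLang : Language ℕ := leadLang * (char 1 * (char 0).star).matches'

lemma mem_mul_singleton {α : Type*} (L : Language α) (w : List α) (a b : α) :
    w ++ [a] ∈ L * ({[b]} : Language α) ↔ w ∈ L ∧ a = b := by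
  rw [Language.mem_mul]
  constructor
  · rintro ⟨u, hu, v, rfl, h⟩
    obtain ⟨rfl, h⟩ := List.append_inj' h rfl
    simp_all
  · rintro ⟨h, rfl⟩
    exact ⟨w, h, [a], rfl, rfl⟩

lemma append_singleton_mem_singleton {α : Type*} (w : List α) (a b : α) :
    w ++ [a] ∈ ({[b]} : Language α) ↔ w = [] ∧ a = b := by
  change w ++ [a] = [b] ↔ _
  cases w <;> simp

/-- The star is unfolded on its right, since passing from `n` to `2n + b` appends the digit `b` at
the right end. -/
lemma leadLang_eq : leadLang = {[1]} + loopLang * {[0]} := by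
  simp only [leadLang, loopLang, RegularExpression.matches'_mul, RegularExpression.matches'_star,
    RegularExpression.matches'_char]
  conv_lhs => rw [← Language.one_add_kstar_mul_self_eq_kstar]
  rw [mul_add, mul_one]
  simp only [mul_assoc]

lemma loopLang_eq : loopLang = leadLang * {[0]} + loopLang * {[1]} := by
  simp only [loopLang, RegularExpression.matches'_mul, RegularExpression.matches'_star,
    RegularExpression.matches'_char]
  conv_lhs => rw [← Language.one_add_kstar_mul_self_eq_kstar]
  simp only [mul_add, mul_one, mul_assoc]

lemma tailLang_eq : tailLang = leadLang * {[1]} + tailLang * {[0]} := by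
  simp only [tailLang, RegularExpression.matches'_mul, RegularExpression.matches'_star,
    RegularExpression.matches'_char]
  conv_lhs => rw [← Language.one_add_kstar_mul_self_eq_kstar]
  simp only [mul_add, mul_one, mul_assoc]

lemma borderedLengthRegex_matches_eq : borderedLengthRegex.matches' = tailLang * {[1]} := by
  simp only [borderedLengthRegex, tailLang, leadLang, RegularExpression.matches'_mul,
    RegularExpression.matches'_star, RegularExpression.matches'_char, mul_assoc]

lemma append_mem_leadLang (w : List ℕ) (a : ℕ) :
    w ++ [a] ∈ leadLang ↔ (w = [] ∧ a = 1) ∨ (w ∈ loopLang ∧ a = 0) := by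
  conv_lhs => rw [leadLang_eq]
  rw [Language.mem_add, append_singleton_mem_singleton, mem_mul_singleton]

lemma append_mem_loopLang (w : List ℕ) (a : ℕ) :
    w ++ [a] ∈ loopLang ↔ (w ∈ leadLang ∧ a = 0) ∨ (w ∈ loopLang ∧ a = 1) := by
  conv_lhs => rw [loopLang_eq]
  rw [Language.mem_add, mem_mul_singleton, mem_mul_singleton]

lemma append_mem_tailLang (w : List ℕ) (a : ℕ) :
    w ++ [a] ∈ tailLang ↔ (w ∈ leadLang ∧ a = 1) ∨ (w ∈ tailLang ∧ a = 0) := by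
  conv_lhs => rw [tailLang_eq]
  rw [Language.mem_add, mem_mul_singleton, mem_mul_singleton]

lemma append_mem_borderedLengthRegex (w : List ℕ) (a : ℕ) :
    w ++ [a] ∈ borderedLengthRegex.matches' ↔ w ∈ tailLang ∧ a = 1 := by
  rw [borderedLengthRegex_matches_eq, mem_mul_singleton]

lemma nil_notMem_leadLang : [] ∉ leadLang := by
  intro h
  rw [leadLang_eq, Language.mem_add] at h
  rcases h with h | h
  · exact absurd (show [] = [1] from h) (by simp)
  · obtain ⟨u, -, v, rfl, h⟩ := Language.mem_mul.1 h
    simp at h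

lemma nil_notMem_loopLang : [] ∉ loopLang := by
  intro h
  obtain ⟨u, hu, v, -, h⟩ := Language.mem_mul.1 h
  obtain ⟨rfl, -⟩ := List.append_eq_nil_iff.1 h
  exact nil_notMem_leadLang hu

lemma nil_notMem_tailLang : [] ∉ tailLang := by
  intro h
  obtain ⟨u, hu, v, -, h⟩ := Language.mem_mul.1 h
  obtain ⟨rfl, -⟩ := List.append_eq_nil_iff.1 h
  exact nil_notMem_leadLang hu

lemma nil_notMem_borderedLengthRegex : [] ∉ borderedLengthRegex.matches' := by
  rw [borderedLengthRegex_matches_eq]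
  intro h
  obtain ⟨u, hu, v, -, h⟩ := Language.mem_mul.1 h
  obtain ⟨rfl, -⟩ := List.append_eq_nil_iff.1 h
  exact nil_notMem_tailLang hu

lemma binaryRep_zero : binaryRep 0 = [] := by simp [binaryRep]

lemma binaryRep_one : binaryRep 1 = [] ++ [1] := by simp [binaryRep]

lemma binaryRep_two_mul_add (n : ℕ) (hn : 0 < n) (b : Bool) :
    binaryRep (2 * n + b.toNat) = binaryRep n ++ [b.toNat] := by
  unfold binaryRep
  rw [add_comm, Nat.digits_add 2 one_lt_two _ _ (by cases b <;> simp) (Or.inr hn.ne')]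
  simp

/-- `w` has reached state `q` of the automaton for `1(01*0)*10*1`: the states `1`, `2`, `3`, `4`
stand for the prefixes `1(01*0)*`, `1(01*0)*01*`, `1(01*0)*10*`, `1(01*0)*10*1`, and any other
value for the words that are none of these. -/
def ReachesState (w : List ℕ) (q : ℕ) : Prop :=
  (w ∈ leadLang ↔ q = 1) ∧ (w ∈ loopLang ↔ q = 2) ∧ (w ∈ tailLang ↔ q = 3) ∧
    (w ∈ borderedLengthRegex.matches' ↔ q = 4)

/-- The transition function of the automaton for `1(01*0)*10*1`. -/
def nextState : ℕ → Bool → ℕ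
  | 1, false => 2
  | 2, false => 1
  | 3, false => 3
  | 1, true => 3
  | 2, true => 2
  | 3, true => 4
  | _, _ => 5

lemma ReachesState.append {w : List ℕ} {q : ℕ} (hw : w ≠ []) (h : ReachesState w q) (b : Bool) :
    ReachesState (w ++ [b.toNat]) (nextState q b) := by
  obtain ⟨h1, h2, h3, -⟩ := h
  unfold ReachesState
  rw [append_mem_leadLang, append_mem_loopLang, append_mem_tailLang,
    append_mem_borderedLengthRegex, h1, h2, h3]
  simp only [hw, false_and, false_or]
  unfold nextState
  cases b <;> split <;> simp_all

lemma reachesState_one : ReachesState (binaryRep 1) 1 := by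
  unfold ReachesState
  rw [binaryRep_one, append_mem_leadLang, append_mem_loopLang, append_mem_tailLang,
    append_mem_borderedLengthRegex]
  simp [nil_notMem_leadLang, nil_notMem_loopLang, nil_notMem_tailLang]

lemma binaryRep_ne_nil {n : ℕ} (hn : 0 < n) : binaryRep n ≠ [] := by
  simp [binaryRep, Nat.digits_ne_nil_iff_ne_zero, hn.ne']

lemma ReachesState.binaryRep_two_mul_add {n q : ℕ} (hn : 0 < n) (h : ReachesState (binaryRep n) q)
    (b : Bool) : ReachesState (binaryRep (2 * n + b.toNat)) (nextState q b) := by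
  rw [_root_.binaryRep_two_mul_add n hn]
  exact h.append (binaryRep_ne_nil hn) b

/-! ### Local structure of the Thue–Morse sequence -/

/-- The Thue–Morse sequence with Boolean values. -/
def thueMorseBool (n : ℕ) : Bool := decide (thueMorse n = 1)

lemma thueMorse_two_mul_add (n : ℕ) (b : Bool) :
    thueMorse (2 * n + b.toNat) = (thueMorse n + b.toNat) % 2 := by
  unfold thueMorse
  by_cases h : b = false ∧ n = 0
  · obtain ⟨rfl, rfl⟩ := h
    simp
  · rw [add_comm, Nat.digits_add 2 one_lt_two _ _ (by cases b <;> simp)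
      (by cases b <;> simp_all)]
    simp only [List.sum_cons]
    omega

lemma thueMorse_lt_two (n : ℕ) : thueMorse n < 2 := Nat.mod_lt _ two_pos

lemma thueMorseBool_two_mul (n : ℕ) : thueMorseBool (2 * n) = thueMorseBool n := by
  have h := thueMorse_two_mul_add n false
  have := thueMorse_lt_two n
  simp only [Bool.toNat_false, add_zero] at h
  simp only [thueMorseBool, h, Nat.mod_eq_of_lt this]

lemma thueMorseBool_two_mul_add_one (n : ℕ) : thueMorseBool (2 * n + 1) = !thueMorseBool n := by
  have h := thueMorse_two_mul_add n true
  have := thueMorse_lt_two n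
  simp only [Bool.toNat_true] at h
  simp only [thueMorseBool, h]
  interval_cases thueMorse n <;> rfl

lemma thueMorseBool_inj {m n : ℕ} :
    thueMorseBool m = thueMorseBool n ↔ thueMorse m = thueMorse n := by
  have := thueMorse_lt_two n
  have := thueMorse_lt_two m
  simp only [thueMorseBool, decide_eq_decide]
  omega

lemma thueMorseBool_two_mul_add (n : ℕ) (a : Bool) :
    thueMorseBool (2 * n + a.toNat) = (a ^^ thueMorseBool n) := by
  cases a <;> simp [thueMorseBool_two_mul, thueMorseBool_two_mul_add_one]

lemma thueMorseBool_two_mul_add_add_one (n : ℕ) (a : Bool) :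
    thueMorseBool (2 * n + a.toNat + 1) = if a then thueMorseBool (n + 1) else !thueMorseBool n := by
  cases a
  · simp [thueMorseBool_two_mul_add_one]
  · simpa [mul_add, add_assoc] using thueMorseBool_two_mul (n + 1)

lemma thueMorseBool_two_mul_add_add_two (n : ℕ) (a : Bool) :
    thueMorseBool (2 * n + a.toNat + 2) = (a ^^ thueMorseBool (n + 1)) := by
  rw [← thueMorseBool_two_mul_add]
  congr 1
  ring

/-- The Thue–Morse sequence contains no cube of a letter. -/
lemma thueMorseBool_no_cube (n : ℕ) :
    ¬ (thueMorseBool n = thueMorseBool (n + 1) ∧ thueMorseBool (n + 1) = thueMorseBool (n + 2)) := by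
  rintro ⟨h, h'⟩
  obtain ⟨m, rfl | rfl⟩ := Nat.even_or_odd' n
  · simp [thueMorseBool_two_mul, thueMorseBool_two_mul_add_one] at h
  · rw [show 2 * m + 1 + 1 = 2 * (m + 1) by ring, show 2 * m + 1 + 2 = 2 * (m + 1) + 1 by ring,
      thueMorseBool_two_mul, thueMorseBool_two_mul_add_one] at h'
    simp at h'

/-- The even-aligned block has the form `x x̄ y ȳ`. Matching it with the odd-aligned one forces
`t(v) = t(v+1) = t(v+2)`, a cube. -/
lemma thueMorseBool_four_even_odd (u v : ℕ) (h : ∀ i < 4,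
    thueMorseBool (2 * u + i) = thueMorseBool (2 * v + 1 + i)) : False := by
  have h0 := h 0 (by norm_num)
  have h1 := h 1 (by norm_num)
  have h2 := h 2 (by norm_num)
  have h3 := h 3 (by norm_num)
  rw [show 2 * v + 1 + 1 = 2 * (v + 1) by ring] at h1
  rw [show 2 * v + 1 + 2 = 2 * (v + 1) + 1 by ring, show 2 * u + 2 = 2 * (u + 1) by ring] at h2
  rw [show 2 * v + 1 + 3 = 2 * (v + 2) by ring, show 2 * u + 3 = 2 * (u + 1) + 1 by ring] at h3
  simp only [add_zero, thueMorseBool_two_mul, thueMorseBool_two_mul_add_one] at h0 h1 h2 h3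
  apply thueMorseBool_no_cube v
  rw [h0] at h1
  rw [h2] at h3
  simp_all

/-- Two equal factors of length four occur at positions of the same parity. -/
lemma thueMorseBool_four_parity (m p : ℕ) (hp : p % 2 = 1) :
    ¬ ∀ i < 4, thueMorseBool (m + i) = thueMorseBool (m + p + i) := by
  intro h
  obtain ⟨q, rfl⟩ : ∃ q, p = 2 * q + 1 := ⟨p / 2, by omega⟩
  obtain ⟨u, rfl | rfl⟩ := Nat.even_or_odd' m
  · exact thueMorseBool_four_even_odd u (u + q) fun i hi => by
      rw [h i hi]; congr 1; ring
  · exact thueMorseBool_four_even_odd (u + q + 1) u fun i hi => by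
      rw [h i hi]; congr 1; ring

/-! ### Periods and borders under doubling -/

/-- The part of the Thue–Morse sequence in `[j, k)` has period `p`. -/
def HasPeriodOn (j k p : ℕ) : Prop :=
  ∀ i, j ≤ i → i + p < k → thueMorseBool i = thueMorseBool (i + p)

/-- The factor of the Thue–Morse sequence at `[j, k)` has no proper border of length above `f`. -/
def NoBorderAbove (f j k : ℕ) : Prop :=
  ∀ p, 0 < p → j + p + f < k → ¬ HasPeriodOn j k p

/-- `[J, E+2)` is the smallest parent covering the child. `hlt` makes the child's border nonempty:
for `a = 1`, `c = 0`, a parent border of length 1 would shrink to length 0. -/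
lemma hasPeriodOn_double (J E p : ℕ) (a c : Bool)
    (hlt : 2 * J + a.toNat + 2 * p < 2 * E + c.toNat + 3) :
    HasPeriodOn (2 * J + a.toNat) (2 * E + c.toNat + 3) (2 * p) ↔ HasPeriodOn J (E + 2) p := by
  have ha := a.toNat_le
  have hc := c.toNat_le
  constructor
  · intro h i hi hi'
    by_cases hle : 2 * J + a.toNat ≤ 2 * i
    · have := h (2 * i) hle (by omega)
      rwa [← mul_add, thueMorseBool_two_mul, thueMorseBool_two_mul] at this
    -- Here `i = J` and `a = 1`: the child contains only the odd half of the first block.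
    · have := h (2 * i + 1) (by omega) (by omega)
      rw [show 2 * i + 1 + 2 * p = 2 * (i + p) + 1 by ring, thueMorseBool_two_mul_add_one,
        thueMorseBool_two_mul_add_one] at this
      simpa using this
  · intro h i hi hi'
    obtain ⟨m, rfl | rfl⟩ := Nat.even_or_odd' i
    · rw [← mul_add, thueMorseBool_two_mul, thueMorseBool_two_mul]
      exact h m (by omega) (by omega)
    · rw [show 2 * m + 1 + 2 * p = 2 * (m + p) + 1 by ring, thueMorseBool_two_mul_add_one,
        thueMorseBool_two_mul_add_one, h m (by omega) (by omega)]

/-- No border of length `1`, `2` or `3` whose shift is odd, for a factor that starts at a position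
of parity `a` with the letters `x₀ x₁ x₂`, and whose last three letters `y₀ y₁ y₂` start at a
position of parity `c`; borders of length `1` are disregarded if `f` is set. -/
def shortBordersAbsent (a c f x₀ x₁ x₂ y₀ y₁ y₂ : Bool) : Bool :=
  if a = c then !(x₀ == y₁ && x₁ == y₂)
  else (f || x₀ != y₂) && !(x₀ == y₀ && x₁ == y₁ && x₂ == y₂)

/-- The flag of a parent: whether borders of length `1` may be present there. -/
def parentFlag (a c f : Bool) : Bool := (a && !c) || (a && f) || (!c && f)

lemma hasPeriodOn_of_length_three {j e : ℕ} {p : ℕ} (h : j + p = e) :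
    HasPeriodOn j (e + 3) p ↔ thueMorseBool j = thueMorseBool e ∧
      thueMorseBool (j + 1) = thueMorseBool (e + 1) ∧
      thueMorseBool (j + 2) = thueMorseBool (e + 2) := by
  subst h
  constructor
  · intro h
    refine ⟨h j le_rfl (by omega), ?_, ?_⟩
    · rw [h (j + 1) (by omega) (by omega)]; congr 1; ring
    · rw [h (j + 2) (by omega) (by omega)]; congr 1; ring
  · rintro ⟨h0, h1, h2⟩ i hi hi'
    obtain rfl | rfl | rfl : i = j ∨ i = j + 1 ∨ i = j + 2 := by omega
    · exact h0
    · rw [h1]; congr 1; ring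
    · rw [h2]; congr 1; ring

lemma hasPeriodOn_of_length_two {j e : ℕ} {p : ℕ} (h : j + p = e + 1) :
    HasPeriodOn j (e + 3) p ↔ thueMorseBool j = thueMorseBool (e + 1) ∧
      thueMorseBool (j + 1) = thueMorseBool (e + 2) := by
  constructor
  · intro h'
    refine ⟨?_, ?_⟩
    · rw [h' j le_rfl (by omega), h]
    · rw [h' (j + 1) (by omega) (by omega)]; congr 1; omega
  · rintro ⟨h0, h1⟩ i hi hi'
    obtain rfl | rfl : i = j ∨ i = j + 1 := by omega
    · rw [h0, h]
    · rw [h1]; congr 1; omega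

lemma hasPeriodOn_of_length_one {j e : ℕ} {p : ℕ} (h : j + p = e + 2) :
    HasPeriodOn j (e + 3) p ↔ thueMorseBool j = thueMorseBool (e + 2) := by
  constructor
  · intro h'
    rw [h' j le_rfl (by omega), h]
  · rintro h0 i hi hi'
    obtain rfl : i = j := by omega
    rw [h0, h]

/-- A parent border of length `l` gives a child border of length `2l - 1 + c - a`. For `l ≥ 2` this
exceeds 1; for `l = 1` it is 0, 1 or 2, which is why `parentFlag` is true, `f` or false
respectively. Odd shifts are left to `shortBordersAbsent`. -/
lemma noBorderAbove_double (J E : ℕ) (a c f : Bool)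
    (hlen : 2 * J + a.toNat ≤ 2 * E + c.toNat) :
    NoBorderAbove f.toNat (2 * J + a.toNat) (2 * E + c.toNat + 3) ↔
      NoBorderAbove (parentFlag a c f).toNat J (E + 2) ∧
      shortBordersAbsent a c f
        (thueMorseBool (2 * J + a.toNat)) (thueMorseBool (2 * J + a.toNat + 1))
        (thueMorseBool (2 * J + a.toNat + 2))
        (thueMorseBool (2 * E + c.toNat)) (thueMorseBool (2 * E + c.toNat + 1))
        (thueMorseBool (2 * E + c.toNat + 2)) = true := by
  have hflag : ∀ p, 2 * J + a.toNat + 2 * p + f.toNat < 2 * E + c.toNat + 3 ↔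
      J + p + (parentFlag a c f).toNat < E + 2 := by
    intro p
    cases a <;> cases c <;> cases f <;> simp [parentFlag] <;> omega
  have ha := a.toNat_le
  have hc := c.toNat_le
  have hf := f.toNat_le
  set j := 2 * J + a.toNat with hj
  set e := 2 * E + c.toNat with he
  constructor
  · intro h
    refine ⟨fun p hp hlt hper => ?_, ?_⟩
    · exact h (2 * p) (by omega) ((hflag p).2 hlt)
        ((hasPeriodOn_double J E p a c (by have := (hflag p).2 hlt; omega)).2 hper)
    · unfold shortBordersAbsent
      split_ifs with hac
      · subst hac
        have := h (e + 1 - j) (by omega) (by omega)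
        rw [hasPeriodOn_of_length_two (by omega)] at this
        simpa [imp_iff_not_or] using this
      · have hne : a.toNat ≠ c.toNat := by cases a <;> cases c <;> simp_all
        have h3 := h (e - j) (by omega) (by omega)
        rw [hasPeriodOn_of_length_three (by omega)] at h3
        have h1 : f = true ∨ ¬ thueMorseBool j = thueMorseBool (e + 2) := by
          cases f
          · right
            rw [← hasPeriodOn_of_length_one (p := e + 2 - j) (by omega)]
            exact h _ (by omega) (by simp; omega)
          · exact Or.inl rfl
        simp only [Bool.and_eq_true, Bool.or_eq_true, bne_iff_ne, ne_eq, Bool.not_eq_true',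
          ← Bool.not_eq_true, beq_iff_eq]
        exact ⟨h1, fun hh => h3 ⟨hh.1.1, hh.1.2, hh.2⟩⟩
  · rintro ⟨h, hs⟩ p hp hlt hper
    obtain ⟨q, rfl | rfl⟩ := Nat.even_or_odd' p
    · exact h q (by omega) ((hflag q).1 hlt) ((hasPeriodOn_double J E q a c (by omega)).1 hper)
    · by_cases h4 : j + (2 * q + 1) + 4 ≤ e + 3
      · refine thueMorseBool_four_parity j (2 * q + 1) (by omega) fun i hi => ?_
        rw [hper (j + i) (by omega) (by omega)]
        congr 1
        ring
      · unfold shortBordersAbsent at hs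
        split_ifs at hs with hac
        · subst hac
          rw [hasPeriodOn_of_length_two (by omega)] at hper
          simp [hper] at hs
        · have hne : a.toNat ≠ c.toNat := by cases a <;> cases c <;> simp_all
          -- For `a ≠ c` the factor has even length, so an odd shift leaves a border of odd length.
          obtain h3 | h1 : j + (2 * q + 1) = e ∨ j + (2 * q + 1) = e + 2 := by omega
          · rw [hasPeriodOn_of_length_three h3] at hper
            simp [hper] at hs
          · rw [hasPeriodOn_of_length_one h1] at hper
            obtain rfl : f = false := by
              cases f
              · rfl
              · simp at hlt; omega
            simp [hper] at hs

/-! ### Profiles and their recursion -/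

/-- Some factor of length `n` of the Thue–Morse sequence begins with `x₀ x₁`, ends with `y₀ y₁` and
has no proper border, except possibly of length `1` if `f` is set. -/
def HasProfile (n : ℕ) (f x₀ x₁ y₀ y₁ : Bool) : Prop :=
  ∃ j e, j + n = e + 2 ∧ thueMorseBool j = x₀ ∧ thueMorseBool (j + 1) = x₁ ∧
    thueMorseBool e = y₀ ∧ thueMorseBool (e + 1) = y₁ ∧ NoBorderAbove f.toNat j (e + 2)

/-- How the profile of a factor at `[2J+a, 2E+c+3)` arises from the letters `u₀ u₁`, `v₀ v₁` at the
ends of the factor at `[J, E+2)`. -/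
def ProfileStep (a c f u₀ u₁ v₀ v₁ x₀ x₁ y₀ y₁ : Bool) : Prop :=
  x₀ = (a ^^ u₀) ∧ x₁ = (if a then u₁ else !u₀) ∧ y₀ = (if c then v₁ else !v₀) ∧ y₁ = (c ^^ v₁) ∧
    shortBordersAbsent a c f x₀ x₁ (a ^^ u₁) (c ^^ v₀) y₀ y₁ = true

instance (a c f u₀ u₁ v₀ v₁ x₀ x₁ y₀ y₁ : Bool) :
    Decidable (ProfileStep a c f u₀ u₁ v₀ v₁ x₀ x₁ y₀ y₁) :=
  inferInstanceAs (Decidable (_ ∧ _))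

lemma HasProfile.step {n N : ℕ} {a c f u₀ u₁ v₀ v₁ x₀ x₁ y₀ y₁ : Bool} (hn : 3 ≤ n)
    (hN : n + 1 + a.toNat = 2 * N + c.toNat) (h : HasProfile N (parentFlag a c f) u₀ u₁ v₀ v₁)
    (hs : ProfileStep a c f u₀ u₁ v₀ v₁ x₀ x₁ y₀ y₁) : HasProfile n f x₀ x₁ y₀ y₁ := by
  obtain ⟨J, E, hJE, rfl, rfl, rfl, rfl, hb⟩ := h
  obtain ⟨rfl, rfl, rfl, rfl, hs⟩ := hs
  refine ⟨2 * J + a.toNat, 2 * E + c.toNat + 1, by omega, ?_, ?_, ?_, ?_, ?_⟩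
  · rw [thueMorseBool_two_mul_add]
  · rw [thueMorseBool_two_mul_add_add_one]
  · rw [thueMorseBool_two_mul_add_add_one]
  · rw [← thueMorseBool_two_mul_add_add_two]
  · rw [show 2 * E + c.toNat + 1 + 2 = 2 * E + c.toNat + 3 by ring,
      noBorderAbove_double J E a c f (by omega)]
    refine ⟨hb, ?_⟩
    simpa only [thueMorseBool_two_mul_add, thueMorseBool_two_mul_add_add_one,
      thueMorseBool_two_mul_add_add_two] using hs

lemma HasProfile.exists_step {n : ℕ} {f x₀ x₁ y₀ y₁ : Bool} (hn : 3 ≤ n)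
    (h : HasProfile n f x₀ x₁ y₀ y₁) : ∃ (a c : Bool) (N : ℕ), n + 1 + a.toNat = 2 * N + c.toNat ∧
      ∃ u₀ u₁ v₀ v₁, HasProfile N (parentFlag a c f) u₀ u₁ v₀ v₁ ∧
        ProfileStep a c f u₀ u₁ v₀ v₁ x₀ x₁ y₀ y₁ := by
  have hdecomp : ∀ m : ℕ, ∃ (k : ℕ) (a : Bool), m = 2 * k + a.toNat := fun m => by
    obtain ⟨k, rfl | rfl⟩ := Nat.even_or_odd' m
    · exact ⟨k, false, rfl⟩
    · exact ⟨k, true, rfl⟩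
  obtain ⟨j, e', hje, rfl, rfl, rfl, rfl, hb⟩ := h
  obtain ⟨e, rfl⟩ : ∃ e, e' = e + 1 := ⟨e' - 1, by omega⟩
  obtain ⟨J, a, rfl⟩ := hdecomp j
  obtain ⟨E, c, rfl⟩ := hdecomp e
  have ha := a.toNat_le
  have hc := c.toNat_le
  rw [show 2 * E + c.toNat + 1 + 2 = 2 * E + c.toNat + 3 by ring,
    noBorderAbove_double J E a c f (by omega)] at hb
  refine ⟨a, c, E + 2 - J, by omega, thueMorseBool J, thueMorseBool (J + 1), thueMorseBool E,
    thueMorseBool (E + 1), ⟨J, E, by omega, rfl, rfl, rfl, rfl, hb.1⟩, ?_⟩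
  have hs := hb.2
  simp only [thueMorseBool_two_mul_add, thueMorseBool_two_mul_add_add_one,
    thueMorseBool_two_mul_add_add_two] at hs
  refine ⟨?_, ?_, ?_, ?_, ?_⟩
  · rw [thueMorseBool_two_mul_add]
  · rw [thueMorseBool_two_mul_add_add_one]
  · rw [thueMorseBool_two_mul_add_add_one]
  · rw [← thueMorseBool_two_mul_add_add_two]
  · simpa only [thueMorseBool_two_mul_add, thueMorseBool_two_mul_add_add_one,
      show 2 * E + c.toNat + 1 + 1 = 2 * E + c.toNat + 2 by ring,
      thueMorseBool_two_mul_add_add_two] using hs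

lemma hasProfile_even {n : ℕ} (hn : 2 ≤ n) (f x₀ x₁ y₀ y₁ : Bool) :
    HasProfile (2 * n) f x₀ x₁ y₀ y₁ ↔ ∃ u₀ u₁ v₀ v₁,
      (HasProfile n (parentFlag false true f) u₀ u₁ v₀ v₁ ∧
        ProfileStep false true f u₀ u₁ v₀ v₁ x₀ x₁ y₀ y₁) ∨
      (HasProfile (n + 1) (parentFlag true false f) u₀ u₁ v₀ v₁ ∧
        ProfileStep true false f u₀ u₁ v₀ v₁ x₀ x₁ y₀ y₁) := by
  constructor
  · intro h
    obtain ⟨a, c, N, hN, u₀, u₁, v₀, v₁, hu, hs⟩ := h.exists_step (by omega)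
    refine ⟨u₀, u₁, v₀, v₁, ?_⟩
    cases a <;> cases c <;> simp at hN
    · omega
    · obtain rfl : N = n := by omega
      exact Or.inl ⟨hu, hs⟩
    · obtain rfl : N = n + 1 := by omega
      exact Or.inr ⟨hu, hs⟩
    · omega
  · rintro ⟨u₀, u₁, v₀, v₁, ⟨hu, hs⟩ | ⟨hu, hs⟩⟩
    · exact hu.step (by omega) (by simp) hs
    · exact hu.step (by omega) (by simp; omega) hs

lemma hasProfile_odd {n : ℕ} (hn : 1 ≤ n) (f x₀ x₁ y₀ y₁ : Bool) :
    HasProfile (2 * n + 1) f x₀ x₁ y₀ y₁ ↔ ∃ a u₀ u₁ v₀ v₁,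
      HasProfile (n + 1) (parentFlag a a f) u₀ u₁ v₀ v₁ ∧
        ProfileStep a a f u₀ u₁ v₀ v₁ x₀ x₁ y₀ y₁ := by
  constructor
  · intro h
    obtain ⟨a, c, N, hN, u₀, u₁, v₀, v₁, hu, hs⟩ := h.exists_step (by omega)
    cases a <;> cases c <;> simp at hN
    · obtain rfl : N = n + 1 := by omega
      exact ⟨_, u₀, u₁, v₀, v₁, hu, hs⟩
    · omega
    · omega
    · obtain rfl : N = n + 1 := by omega
      exact ⟨_, u₀, u₁, v₀, v₁, hu, hs⟩
  · rintro ⟨a, u₀, u₁, v₀, v₁, hu, hs⟩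
    exact hu.step (by omega) (by omega) hs

/-! ### The finite set of classes -/

/-- The eight sets of profiles that occur for a length `n ≥ 2`, coded as bit masks. -/
def profileMask : Fin 8 → ℕ :=
  -- The low sixteen bits are the profiles with `f = false`; they all vanish only for class 5.
  ![0x84210420, 0x43c24182, 0x3a5c1008, 0x69964182, 0x53ca518a, 0x2a540000, 0x6bd64182, 0x7bde518a]

/-- Membership in one of the eight sets of profiles. -/
def inClass (k : Fin 8) (f x₀ x₁ y₀ y₁ : Bool) : Bool :=
  (profileMask k).testBit
    (16 * f.toNat + 8 * x₀.toNat + 4 * x₁.toNat + 2 * y₀.toNat + y₁.toNat)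

/-- The factors of length `n` have exactly the profiles in class `k`. -/
def HasClass (n : ℕ) (k : Fin 8) : Prop :=
  ∀ f x₀ x₁ y₀ y₁, HasProfile n f x₀ x₁ y₀ y₁ ↔ inClass k f x₀ x₁ y₀ y₁ = true

/-- The classes `k`, `l` of `n`, `n + 1` determine the class `m` of `2n`. -/
def EvenStep (k l m : Fin 8) : Prop :=
  ∀ f x₀ x₁ y₀ y₁, (∃ u₀ u₁ v₀ v₁,
      (inClass k (parentFlag false true f) u₀ u₁ v₀ v₁ = true ∧
        ProfileStep false true f u₀ u₁ v₀ v₁ x₀ x₁ y₀ y₁) ∨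
      (inClass l (parentFlag true false f) u₀ u₁ v₀ v₁ = true ∧
        ProfileStep true false f u₀ u₁ v₀ v₁ x₀ x₁ y₀ y₁)) ↔ inClass m f x₀ x₁ y₀ y₁ = true

/-- The class `l` of `n + 1` determines the class `m` of `2n + 1`. -/
def OddStep (l m : Fin 8) : Prop :=
  ∀ f x₀ x₁ y₀ y₁, (∃ a u₀ u₁ v₀ v₁,
      inClass l (parentFlag a a f) u₀ u₁ v₀ v₁ = true ∧
        ProfileStep a a f u₀ u₁ v₀ v₁ x₀ x₁ y₀ y₁) ↔ inClass m f x₀ x₁ y₀ y₁ = true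

instance (k l m : Fin 8) : Decidable (EvenStep k l m) := by unfold EvenStep; infer_instance

instance (l m : Fin 8) : Decidable (OddStep l m) := by unfold OddStep; infer_instance

lemma HasClass.even {n : ℕ} {k l m : Fin 8} (hn : 2 ≤ n) (hk : HasClass n k)
    (hl : HasClass (n + 1) l) (h : EvenStep k l m) : HasClass (2 * n) m := by
  intro f x₀ x₁ y₀ y₁
  rw [hasProfile_even hn, ← h]
  simp only [hk _ _ _ _ _, hl _ _ _ _ _]

lemma HasClass.odd {n : ℕ} {l m : Fin 8} (hn : 1 ≤ n)
    (hl : HasClass (n + 1) l) (h : OddStep l m) : HasClass (2 * n + 1) m := by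
  intro f x₀ x₁ y₀ y₁
  rw [hasProfile_odd hn, ← h]
  simp only [hl _ _ _ _ _]

lemma exists_thueMorseBool_pair (x y : Bool) :
    ∃ j, thueMorseBool j = x ∧ thueMorseBool (j + 1) = y := by
  have h0 : thueMorseBool 0 = false := by decide +kernel
  have h1 : thueMorseBool 1 = true := by decide +kernel
  have h2 : thueMorseBool 2 = true := by decide +kernel
  have h3 : thueMorseBool 3 = false := by decide +kernel
  have h5 : thueMorseBool 5 = false := by decide +kernel
  have h6 : thueMorseBool 6 = false := by decide +kernel
  cases x <;> cases y
  · exact ⟨5, h5, h6⟩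
  · exact ⟨0, h0, h1⟩
  · exact ⟨2, h2, h3⟩
  · exact ⟨1, h1, h2⟩

lemma noBorderAbove_length_two (f : Bool) (j : ℕ) :
    NoBorderAbove f.toNat j (j + 2) ↔ f = true ∨ thueMorseBool j ≠ thueMorseBool (j + 1) := by
  constructor
  · intro h
    cases f
    · right
      intro heq
      refine h 1 one_pos (by simp) fun i hi hi' => ?_
      obtain rfl : i = j := by omega
      exact heq
    · exact Or.inl rfl
  · rintro h p hp hlt hper
    have := f.toNat_le
    obtain rfl : p = 1 := by omega
    rcases h with rfl | h
    · simp at hlt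
    · exact h (hper j le_rfl (by omega))

lemma hasProfile_two (f x₀ x₁ y₀ y₁ : Bool) :
    HasProfile 2 f x₀ x₁ y₀ y₁ ↔ x₀ = y₀ ∧ x₁ = y₁ ∧ (f = true ∨ x₀ ≠ x₁) := by
  constructor
  · rintro ⟨j, e, h, rfl, rfl, rfl, rfl, hb⟩
    obtain rfl : j = e := by omega
    exact ⟨rfl, rfl, (noBorderAbove_length_two f j).1 hb⟩
  · rintro ⟨rfl, rfl, h⟩
    obtain ⟨j, rfl, rfl⟩ := exists_thueMorseBool_pair x₀ x₁
    exact ⟨j, j, rfl, rfl, rfl, rfl, rfl, (noBorderAbove_length_two f j).2 h⟩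

lemma hasClass_two : HasClass 2 0 := by
  intro f x₀ x₁ y₀ y₁
  rw [hasProfile_two]
  revert f x₀ x₁ y₀ y₁
  decide +kernel

/-! ### The product automaton -/

/-- The regex state of `n` and the classes of `n`, `n + 1`, `n + 2`, for the states of the product
automaton. -/
def productLabel : Fin 14 → ℕ × Fin 8 × Fin 8 × Fin 8 :=
  ![(2, 0, 1, 2), (3, 1, 2, 3), (1, 2, 3, 4), (2, 3, 4, 5), (3, 4, 5, 3), (4, 5, 3, 6),
    (2, 3, 6, 2), (3, 6, 2, 3), (5, 3, 6, 7), (5, 6, 7, 6), (1, 7, 6, 4), (2, 6, 4, 5),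
    (5, 7, 6, 7), (2, 7, 6, 2)]

/-- The transitions of the product automaton. -/
def productNext : Fin 14 → Bool → Fin 14 :=
  fun i b => (if b then ![3, 5, 7, 3, 5, 9, 11, 5, 9, 9, 7, 3, 9, 11]
    else ![2, 4, 6, 2, 4, 8, 10, 4, 12, 12, 13, 2, 12, 10] : Fin 14 → Fin 14) i

/-- The state `i` of the product automaton describes the length `n`. -/
def Describes (i : Fin 14) (n : ℕ) : Prop :=
  ReachesState (binaryRep n) (productLabel i).1 ∧ HasClass n (productLabel i).2.1 ∧
    HasClass (n + 1) (productLabel i).2.2.1 ∧ HasClass (n + 2) (productLabel i).2.2.2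

lemma productNext_regex (i : Fin 14) (b : Bool) :
    (productLabel (productNext i b)).1 = nextState (productLabel i).1 b := by
  revert i b
  decide +kernel

/-- The parents of `2n`, `2n+1`, `2n+2` have lengths among `n`, `n+1`, `n+2`, so a window of three
consecutive lengths is closed under appending a digit. -/
lemma productNext_false_step (i : Fin 14) :
    EvenStep (productLabel i).2.1 (productLabel i).2.2.1 (productLabel (productNext i false)).2.1 ∧
    OddStep (productLabel i).2.2.1 (productLabel (productNext i false)).2.2.1 ∧
    EvenStep (productLabel i).2.2.1 (productLabel i).2.2.2
      (productLabel (productNext i false)).2.2.2 := by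
  revert i
  decide +kernel

lemma productNext_true_step (i : Fin 14) :
    OddStep (productLabel i).2.2.1 (productLabel (productNext i true)).2.1 ∧
    EvenStep (productLabel i).2.2.1 (productLabel i).2.2.2
      (productLabel (productNext i true)).2.2.1 ∧
    OddStep (productLabel i).2.2.2 (productLabel (productNext i true)).2.2.2 := by
  revert i
  decide +kernel

lemma describes_two : Describes 0 2 := by
  have h3 : HasClass 3 1 := hasClass_two.odd (n := 1) le_rfl (by decide +kernel)
  exact ⟨reachesState_one.binaryRep_two_mul_add one_pos false, hasClass_two, h3,
    hasClass_two.even (n := 2) le_rfl h3 (by decide +kernel)⟩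

lemma describes_three : Describes 1 3 := by
  obtain ⟨-, -, h3, h4⟩ := describes_two
  exact ⟨reachesState_one.binaryRep_two_mul_add one_pos true, h3, h4,
    h3.odd (n := 2) one_le_two (by decide +kernel)⟩

lemma Describes.double {i : Fin 14} {n : ℕ} (hn : 2 ≤ n) (h : Describes i n) :
    Describes (productNext i false) (2 * n) := by
  obtain ⟨hq, h0, h1, h2⟩ := h
  obtain ⟨s0, s1, s2⟩ := productNext_false_step i
  refine ⟨?_, h0.even hn h1 s0, h1.odd (by omega) s1, h1.even (n := n + 1) (by omega) h2 s2⟩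
  rw [productNext_regex]
  exact hq.binaryRep_two_mul_add (by omega) false

lemma Describes.double_add_one {i : Fin 14} {n : ℕ} (hn : 2 ≤ n) (h : Describes i n) :
    Describes (productNext i true) (2 * n + 1) := by
  obtain ⟨hq, -, h1, h2⟩ := h
  obtain ⟨s0, s1, s2⟩ := productNext_true_step i
  refine ⟨?_, h1.odd (by omega) s0, h1.even (n := n + 1) (by omega) h2 s1,
    h2.odd (n := n + 1) (by omega) s2⟩
  rw [productNext_regex]
  exact hq.binaryRep_two_mul_add (by omega) true

lemma exists_describes (n : ℕ) (hn : 2 ≤ n) : ∃ i, Describes i n := by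
  induction n using Nat.strong_induction_on with
  | _ n ih =>
    by_cases h4 : n < 4
    · obtain rfl | rfl : n = 2 ∨ n = 3 := by omega
      · exact ⟨_, describes_two⟩
      · exact ⟨_, describes_three⟩
    · obtain ⟨m, rfl | rfl⟩ := Nat.even_or_odd' n
      · obtain ⟨i, hi⟩ := ih m (by omega) (by omega)
        exact ⟨_, hi.double (by omega)⟩
      · obtain ⟨i, hi⟩ := ih m (by omega) (by omega)
        exact ⟨_, hi.double_add_one (by omega)⟩

/-! ### From borders of words to periods, and the conclusion -/

lemma length_seqFactor {α : Type*} (x : ℕ → α) (j n : ℕ) : (seqFactor x j n).length = n := by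
  simp [seqFactor]

/-- A factor is bordered iff it has some proper period, the shift of a shortest border. -/
lemma isBordered_seqFactor_iff (j n : ℕ) :
    IsBordered (seqFactor thueMorse j n) ↔ ∃ p, 0 < p ∧ p < n ∧ HasPeriodOn j (j + n) p := by
  constructor
  · rintro ⟨u, hu, hlen, ⟨v, hv⟩, ⟨w, hw⟩⟩
    rw [length_seqFactor] at hlen
    have hwl : w.length + u.length = n := by
      rw [← length_seqFactor thueMorse j n, ← hw, List.length_append]
    refine ⟨n - u.length, by omega, by omega, fun i hi hi' => ?_⟩
    obtain ⟨i, rfl⟩ := Nat.exists_eq_add_of_le hi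
    have hiu : i < u.length := by omega
    have h1 : (seqFactor thueMorse j n)[i]? = u[i]? := by
      rw [← hv, List.getElem?_append_left hiu]
    have h2 : (seqFactor thueMorse j n)[w.length + i]? = u[i]? := by
      rw [← hw, List.getElem?_append_right (by omega), Nat.add_sub_cancel_left]
    have h3 := h1.trans h2.symm
    simp only [seqFactor, List.getElem?_map, List.getElem?_range (show i < n by omega),
      List.getElem?_range (show w.length + i < n by omega), Option.map_some,
      Option.some.injEq] at h3
    rw [thueMorseBool_inj, h3]
    congr 1
    omega
  · rintro ⟨p, hp, hpn, hper⟩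
    -- The largest multiple `q` of `p` below `n` is again a period; as `p ≤ q` and `n ≤ q + p`, its
    -- border has length `n - q ≤ n / 2`.
    obtain ⟨q, hq0, hqn, hq2, hqper⟩ :
        ∃ q, 0 < q ∧ q < n ∧ n ≤ 2 * q ∧ HasPeriodOn j (j + n) q := by
      have hmul : ∀ d, HasPeriodOn j (j + n) ((d + 1) * p) := by
        intro d
        induction d with
        | zero => simpa using hper
        | succ d ih =>
          intro i hi hi'
          have : (d + 1 + 1) * p = (d + 1) * p + p := by ring
          rw [ih i hi (by omega), hper (i + (d + 1) * p) (by omega) (by omega), this, add_assoc]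
      have hdiv := Nat.div_add_mod (n - 1) p
      have hmod := Nat.mod_lt (n - 1) hp
      have hpos : 0 < (n - 1) / p := Nat.div_pos (by omega) hp
      obtain ⟨d, hd⟩ : ∃ d, (n - 1) / p = d + 1 := ⟨(n - 1) / p - 1, by omega⟩
      rw [hd, mul_comm] at hdiv
      have hge : p ≤ (d + 1) * p := Nat.le_mul_of_pos_left p (by omega)
      exact ⟨(d + 1) * p, by omega, by omega, by omega, hmul d⟩
    refine ⟨(seqFactor thueMorse j n).drop q, ?_, ?_, ?_, List.drop_suffix _ _⟩
    · rw [List.length_drop, length_seqFactor]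
      omega
    · rw [List.length_drop, length_seqFactor]
      omega
    · have : (seqFactor thueMorse j n).drop q = (seqFactor thueMorse j n).take (n - q) := by
        apply List.ext_getElem
        · simp only [List.length_drop, List.length_take, length_seqFactor]
          omega
        · intro i h1 h2
          simp only [List.length_drop, length_seqFactor] at h1
          have := hqper (j + i) (by omega) (by omega)
          rw [thueMorseBool_inj] at this
          simp only [seqFactor, List.getElem_drop, List.getElem_take, List.getElem_map,
            List.getElem_range]
          rw [this]
          congr 1
          ring
      rw [this]
      exact List.take_prefix _ _

lemma hasUnborderedFactor_iff_exists_profile {n : ℕ} (hn : 2 ≤ n) :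
    HasUnborderedFactor thueMorse n ↔ ∃ x₀ x₁ y₀ y₁, HasProfile n false x₀ x₁ y₀ y₁ := by
  have key : ∀ j, ¬ IsBordered (seqFactor thueMorse j n) ↔ NoBorderAbove 0 j (j + n) := by
    intro j
    rw [isBordered_seqFactor_iff]
    simp only [NoBorderAbove, not_exists, not_and, add_zero, Nat.add_lt_add_iff_left]
  constructor
  · rintro ⟨j, hj⟩
    rw [key] at hj
    obtain ⟨e, he⟩ : ∃ e, j + n = e + 2 := ⟨j + n - 2, by omega⟩
    exact ⟨_, _, _, _, j, e, he, rfl, rfl, rfl, rfl, he ▸ hj⟩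
  · rintro ⟨x₀, x₁, y₀, y₁, j, e, he, -, -, -, -, hb⟩
    refine ⟨j, (key j).2 ?_⟩
    rw [he]
    exact hb

lemma hasUnborderedFactor_of_lt_two {n : ℕ} (hn : n < 2) : HasUnborderedFactor thueMorse n := by
  refine ⟨0, ?_⟩
  rintro ⟨u, hu, hlen, -, -⟩
  rw [length_seqFactor] at hlen
  omega

lemma exists_inClass_iff (i : Fin 14) :
    (∃ x₀ x₁ y₀ y₁, inClass (productLabel i).2.1 false x₀ x₁ y₀ y₁ = true) ↔
      ¬ (productLabel i).1 = 4 := by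
  revert i
  decide +kernel

theorem theorem4 (n : ℕ) :
    HasUnborderedFactor thueMorse n ↔ binaryRep n ∉ borderedLengthRegex.matches' := by
  rcases lt_or_ge n 2 with hn | hn
  · refine iff_of_true (hasUnborderedFactor_of_lt_two hn) ?_
    obtain rfl | rfl : n = 0 ∨ n = 1 := by omega
    · rw [binaryRep_zero]
      exact nil_notMem_borderedLengthRegex
    · rw [reachesState_one.2.2.2]
      norm_num
  · obtain ⟨i, hq, hc, -, -⟩ := exists_describes n hn
    rw [hasUnborderedFactor_iff_exists_profile hn, hq.2.2.2, ← exists_inClass_iff]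
    simp only [hc _ _ _ _ _]
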